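/- Let $(\mathcal E,\rho)$ be a metric space with its Borel $\sigma$-algebra, let $\lambda,\kappa,\mu\colon\mathcal E\to[0,\infty)$ be continuous, and let $(\Omega,\mathcal F,\mathbb P)$ be a probability space carrying the following independent objects: a stochastic process $J=(J(t))_{t\ge 0}$ with state space $\mathcal E$ and càdlàg paths; a standard (unit-rate) Poisson process $\overline Y$; and a sequence $\overline Z_1,\overline Z_2,\dots$ of independent standard exponential random variables. Put $\Lambda(t)=\int_0^t\lambda(J(s))\,ds$ and let $Y(t)=\overline Y(\Lambda(t))$ be the arrival process, with jump times $\tau_1,\tau_2,\dots$, where $\tau_k=\inf\{t\ge 0: Y(t)\ge k\}$ and $\inf\emptyset=\infty$. At time $0$ the system is empty, and job $k$ arrives at time $\tau_k$ with service requirement $Z_k=\overline Z_k/\kappa(J(\tau_k))$ if $\kappa(J(\tau_k))>0$ and $Z_k=\infty$ if $\kappa(J(\tau_k))=0$. Its server works at rate $\mu(J(r))$ at time $r$, and the job leaves when its requirement has been processed. The number of jobs in the system at time $t\ge 0$ is therefore $$M(t)=\sum_{k=1}^{\infty}\Bigl(\mathbf 1\{\tau_k\le t\}-\mathbf 1\{\tau_k\le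 t\}\,\mathbf 1\bigl\{Z_k\le \textstyle\int_{[\tau_k,t)}\mu(J(r))\,dr\bigr\}\Bigr).$$ Then for every $t\ge 0$, almost surely only finitely many $\tau_k$ are at most $t$, and $M(t)$ has a Poisson distribution with random parameter $$\phi_t(J)=\int_0^t\lambda(J(s))\exp\Bigl(-\kappa(J(s))\int_s^t\mu(J(r))\,dr\Bigr)\,ds .$$ That is, $M(t)$ and $\phi_t(J)$ are random variables; conditionally on $\sigma(J(s):s\ge 0)$, $M(t)$ is Poisson distributed with parameter $\phi_t(J)$; and consequently the law of $M(t)$ is the mixed Poisson law $$\mathbb P(M(t)=n)=\mathbb E\Bigl[e^{-\phi_t(J)}\frac{\phi_t(J)^n}{n!}\Bigr],\qquad n=0,1,2,\dots$$ -/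

import Mathlib

open MeasureTheory ProbabilityTheory Filter Topology Set
open scoped NNReal ENNReal

noncomputable section

namespace ModulatedQueue

/-- A function on `[0, ∞)` is càdlàg: right-continuous with left limits in `E`
(at `0` the left neighbourhood filter is trivial, so nothing is asked there). -/
def IsCadlag {E : Type*} [TopologicalSpace E] (f : ℝ≥0 → E) : Prop :=
  ∀ t : ℝ≥0, ContinuousWithinAt f (Ici t) t ∧ ∃ l : E, Tendsto f (𝓝[<] t) (𝓝 l)

/-- A standard (unit rate) Poisson process: a counting process started at `0` whose paths are
nondecreasing and right-continuous, with independent increments, the increment over `(s, t]`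
being Poisson distributed with mean `t - s`. -/
structure IsStandardPoissonProcess {Ω : Type*} [MeasurableSpace Ω]
    (N : ℝ≥0 → Ω → ℕ) (P : Measure Ω) : Prop where
  measurable : ∀ t, Measurable (N t)
  zero : ∀ ω, N 0 ω = 0
  mono : ∀ ω, Monotone fun t => N t ω
  rightCont : ∀ ω t, ContinuousWithinAt (fun s => N s ω) (Ici t) t
  indepIncrements : HasIndepIncrements N P
  law_increment : ∀ s t : ℝ≥0, s ≤ t →
    HasLaw (fun ω => N t ω - N s ω) (poissonMeasure (t - s)) P

/-- The `k`-th jump time (`k ≥ 1`) of a counting path `Y`: the first time at which at least `k`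
jumps have been counted, and `∞` if there is no such time. -/
def jumpTime (Y : ℝ≥0 → ℕ) (k : ℕ) : ℝ≥0∞ :=
  ⨅ (s : ℝ≥0) (_ : k ≤ Y s), (s : ℝ≥0∞)

section Paths

variable {E : Type*} (lam kap mu : E → ℝ≥0)

/-- The cumulative arrival rate `Λ(t) = ∫_0^t λ(f(s)) ds` along a path `f` of the background
process. -/
def cumulativeRate (f : ℝ≥0 → E) (t : ℝ≥0) : ℝ≥0 :=
  ⟨∫ s in (0 : ℝ)..t, (lam (f s.toNNReal) : ℝ),
    intervalIntegral.integral_nonneg t.2 fun _ _ => NNReal.coe_nonneg _⟩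

/-- The arrival counting path `Y(t) = Ybar(Λ(t))`. -/
def arrivals (f : ℝ≥0 → E) (Ybar : ℝ≥0 → ℕ) (t : ℝ≥0) : ℕ :=
  Ybar (cumulativeRate lam f t)

/-- The arrival time `τ_k` of job `k ≥ 1`, the `k`-th jump time of the arrival path. -/
def arrivalTime (f : ℝ≥0 → E) (Ybar : ℝ≥0 → ℕ) (k : ℕ) : ℝ≥0∞ :=
  jumpTime (arrivals lam f Ybar) k

/-- The service requirement of a job that arrives while the background process is in state `x`,
given its standard exponential draw `z`: it is `z / κ(x)` if `κ(x) > 0`, and `∞` otherwise. -/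
def serviceRequirement (x : E) (z : ℝ) : EReal :=
  if 0 < kap x then ((z / (kap x : ℝ) : ℝ) : EReal) else ⊤

/-- The work `∫_{[s,t)} μ(f(r)) dr` that a server performs during `[s, t)`. -/
def workDone (f : ℝ≥0 → E) (s t : ℝ≥0) : ℝ :=
  ∫ r in Ico (s : ℝ) (t : ℝ), (mu (f r.toNNReal) : ℝ)

/-- Job `k` has entered the system at or before time `t`. -/
def HasEntered (f : ℝ≥0 → E) (Ybar : ℝ≥0 → ℕ) (t : ℝ≥0) (k : ℕ) : Prop :=
  arrivalTime lam f Ybar k ≤ t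

/-- Job `k` has both entered and left the system by time `t`: `τ_k ≤ t` and its service
requirement is at most the work performed during `[τ_k, t)`. -/
def HasLeft (f : ℝ≥0 → E) (Ybar : ℝ≥0 → ℕ) (Zbar : ℕ → ℝ) (t : ℝ≥0) (k : ℕ) : Prop :=
  arrivalTime lam f Ybar k ≤ t ∧
    serviceRequirement kap (f (arrivalTime lam f Ybar k).toNNReal) (Zbar k) ≤
      ((workDone mu f (arrivalTime lam f Ybar k).toNNReal t : ℝ) : EReal)

open Classical in
/-- The number of jobs in the system at time `t`, starting empty, with jobs numbered
`k = 1, 2, …`: the sum over all jobs of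
`1{entered by time t} - 1{entered and left by time t}`. -/
def numJobs (f : ℝ≥0 → E) (Ybar : ℝ≥0 → ℕ) (Zbar : ℕ → ℝ) (t : ℝ≥0) : ℕ :=
  ∑' k : ℕ, ((if HasEntered lam f Ybar t (k + 1) then 1 else 0) -
    (if HasLeft lam kap mu f Ybar Zbar t (k + 1) then 1 else 0))

/-- The parameter `φ_t(f) = ∫_0^t λ(f(s)) exp(-κ(f(s)) ∫_s^t μ(f(r)) dr) ds`. -/
def poissonParameter (t : ℝ≥0) (f : ℝ≥0 → E) : ℝ≥0 :=
  ⟨∫ s in (0 : ℝ)..t, (lam (f s.toNNReal) : ℝ) *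
      Real.exp (-(kap (f s.toNNReal) : ℝ) * ∫ r in s..t, (mu (f r.toNNReal) : ℝ)),
    intervalIntegral.integral_nonneg t.2 fun _ _ =>
      mul_nonneg (NNReal.coe_nonneg _) (Real.exp_pos _).le⟩

end Paths

end ModulatedQueue

end

/-! Freeze the background path `f` and compute the generating function of the number of jobs `M` at
a point `u` of the unit circle. Each job in the system contributes a factor `u`, each served one a
factor `1`. Averaging over the independent exponential draws replaces the factor of a job entering
at `τ` by `h τ`, where `h s = 1 + (u - 1) * survival s`. What remains is the expectation of `∏ h
(τ_k)` over the arrivals of a Poisson process with intensity `λ(f(s)) ds`, which is `exp (∫ λ (h -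
1)) = exp (φ (u - 1))`, the generating function of the Poisson law (`integral_pow_numJobs`).

The product formula is `integral_prod_entryTime`. With arrival times rounded up to a grid, the
product becomes a finite product of powers of independent Poisson increments. Refining the grid
gives the formula for `h`, since `h` is right-continuous and of norm at most `1`.

Finally `J` is independent of the pair of driving processes, so Fubini turns the law for each frozen
path into `P (B ∩ {M ∈ A}) = ∫_B Poisson(φ)(A)` for `B` in `σ(J)` (`measure_inter_numJobs`). This
identity characterises the conditional law, and `B = univ` gives the mixture. -/

noncomputable section

namespace ModulatedQueue

/-! ### Rounding up to a grid -/

/-- The least multiple of `δ` that is at least `s` (for `δ > 0`). -/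
def ceilTo (δ s : ℝ≥0) : ℝ≥0 := ⌈s / δ⌉₊ * δ

theorem le_ceilTo {δ : ℝ≥0} (hδ : 0 < δ) (s : ℝ≥0) : s ≤ ceilTo δ s := by
  have := Nat.le_ceil (s / δ)
  rwa [div_le_iff₀ hδ] at this

theorem ceilTo_le_add {δ : ℝ≥0} (hδ : 0 < δ) (s : ℝ≥0) : ceilTo δ s ≤ s + δ := by
  have := (Nat.ceil_lt_add_one (zero_le (a := s / δ))).le
  calc ceilTo δ s ≤ (s / δ + 1) * δ := by unfold ceilTo; gcongr
    _ = s + δ := by rw [add_mul, div_mul_cancel₀ _ hδ.ne', one_mul]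

theorem ceilTo_eq_of_mem_Ioc {δ : ℝ≥0} (hδ : 0 < δ) {i : ℕ} {s : ℝ≥0}
    (h1 : i * δ < s) (h2 : s ≤ (i + 1 : ℕ) * δ) : ceilTo δ s = (i + 1 : ℕ) * δ := by
  have : ⌈s / δ⌉₊ = i + 1 := by
    rw [Nat.ceil_eq_iff (by omega)]
    exact ⟨by simpa using (lt_div_iff₀ hδ).2 h1, (div_le_iff₀ hδ).2 h2⟩
  rw [ceilTo, this]

theorem measurable_ceilTo (δ : ℝ≥0) : Measurable (ceilTo δ) :=
  (measurable_from_nat (f := fun k : ℕ => (k : ℝ≥0) * δ)).comp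
    (Nat.measurable_ceil.comp (measurable_id.div_const δ))

/-- Rounding up, rather than down, approaches `s` from the side on which càdlàg paths are
continuous. -/
theorem tendsto_ceilTo {c : ℝ≥0} (hc : 0 < c) (s : ℝ≥0) :
    Tendsto (fun n : ℕ => ceilTo (c / (n + 1)) s) atTop (𝓝[≥] s) := by
  have hδ (n : ℕ) : 0 < c / ((n : ℝ≥0) + 1) := by positivity
  refine tendsto_nhdsWithin_iff.2 ⟨?_, .of_forall fun n => le_ceilTo (hδ n) s⟩
  have h0 : Tendsto (fun n : ℕ => s + c / ((n : ℝ≥0) + 1)) atTop (𝓝 (s + 0)) := by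
    refine tendsto_const_nhds.add ?_
    simpa [div_eq_mul_inv] using
      (tendsto_one_div_add_atTop_nhds_zero_nat (𝕜 := ℝ≥0)).const_mul c
  rw [add_zero] at h0
  exact tendsto_of_tendsto_of_tendsto_of_le_of_le tendsto_const_nhds h0
    (fun n => le_ceilTo (hδ n) s) (fun n => ceilTo_le_add (hδ n) s)

/-! ### Right-continuous processes -/

/-- With time rounded up to a grid the process involves only countably many measurable maps;
right-continuity makes it the pointwise limit of these discretisations. -/
theorem measurable_uncurry_of_rightCont {Ω β : Type*} [MeasurableSpace Ω] [TopologicalSpace β]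
    [TopologicalSpace.PseudoMetrizableSpace β] [MeasurableSpace β] [BorelSpace β]
    {X : ℝ≥0 → Ω → β} (hX : ∀ t, Measurable (X t))
    (hc : ∀ ω t, ContinuousWithinAt (fun s => X s ω) (Ici t) t) :
    Measurable (fun q : ℝ≥0 × Ω => X q.1 q.2) := by
  refine measurable_of_tendsto_metrizable
    (f := fun (n : ℕ) (q : ℝ≥0 × Ω) => X (ceilTo (1 / (n + 1)) q.1) q.2) (fun n => ?_) ?_
  · have h : Measurable (fun q : ℕ × Ω => X (q.1 * (1 / (n + 1))) q.2) :=
      measurable_from_prod_countable_right fun k => hX (k * (1 / (n + 1)))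
    exact h.comp ((Nat.measurable_ceil.comp (measurable_fst.div_const _)).prodMk measurable_snd)
  · rw [tendsto_pi_nhds]
    exact fun q => (hc q.2 q.1).tendsto.comp (tendsto_ceilTo one_pos q.1)

theorem measurable_of_rightCont {β : Type*} [TopologicalSpace β]
    [TopologicalSpace.PseudoMetrizableSpace β] [MeasurableSpace β] [BorelSpace β]
    {f : ℝ≥0 → β} (hc : ∀ t, ContinuousWithinAt f (Ici t) t) : Measurable f := by
  have := measurable_uncurry_of_rightCont (Ω := Unit) (X := fun t _ => f t)
    (fun t => measurable_const) (fun _ => hc)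
  exact this.comp (measurable_id.prodMk (measurable_const (a := ())))

/-! ### Càdlàg paths -/

theorem IsCadlag.comp {E F : Type*} [TopologicalSpace E] [TopologicalSpace F] {f : ℝ≥0 → E}
    (hf : IsCadlag f) {g : E → F} (hg : Continuous g) : IsCadlag fun s => g (f s) := fun t =>
  ⟨hg.continuousAt.comp_continuousWithinAt (hf t).1,
  let ⟨l, hl⟩ := (hf t).2
  ⟨g l, (hg.tendsto l).comp hl⟩⟩

/-- The one-sided limits bound the path on a neighbourhood of each point, and compactness of `[0,
t]` makes the bound uniform. -/
theorem IsCadlag.bddOn {f : ℝ≥0 → ℝ≥0} (hf : IsCadlag f) (t : ℝ≥0) :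
    ∃ C : ℝ≥0, ∀ s ≤ t, f s ≤ C := by
  have key : ∃ C : ℝ≥0, ∀ s ∈ Icc 0 t, f s ≤ C := by
    refine isCompact_Icc.induction_on (p := fun S => ∃ C : ℝ≥0, ∀ s ∈ S, f s ≤ C)
      ⟨0, by simp⟩ (fun A B hAB ⟨C, hC⟩ => ⟨C, fun s hs => hC s (hAB hs)⟩)
      (fun A B ⟨C, hC⟩ ⟨D, hD⟩ => ⟨max C D, ?_⟩) (fun x _ => ?_)
    · rintro s (hs | hs)
      · exact (hC s hs).trans (le_max_left _ _)
      · exact (hD s hs).trans (le_max_right _ _)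
    · obtain ⟨h1, l, h2⟩ := hf x
      have e1 : ∀ᶠ s in 𝓝[≥] x, f s ≤ max (f x + 1) (l + 1) :=
        (h1.eventually_lt_const (lt_add_one (f x))).mono fun s hs => hs.le.trans (le_max_left _ _)
      have e2 : ∀ᶠ s in 𝓝[<] x, f s ≤ max (f x + 1) (l + 1) :=
        (h2.eventually_lt_const (lt_add_one l)).mono fun s hs => hs.le.trans (le_max_right _ _)
      refine ⟨{s | f s ≤ max (f x + 1) (l + 1)}, mem_nhdsWithin_of_mem_nhds ?_, _, fun s hs => hs⟩
      rw [← nhdsLT_sup_nhdsGE]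
      exact ⟨e2, e1⟩
  exact key.imp fun C hC s hs => hC s ⟨zero_le, hs⟩

theorem IsCadlag.measurable {f : ℝ≥0 → ℝ≥0} (hf : IsCadlag f) : Measurable f :=
  measurable_of_rightCont fun t => (hf t).1

/-- A nonnegative càdlàg path, extended to the real line by its value at `0`. -/
theorem IsCadlag.intervalIntegrable {f : ℝ≥0 → ℝ≥0} (hf : IsCadlag f) (a b : ℝ) :
    IntervalIntegrable (fun s : ℝ => (f s.toNNReal : ℝ)) volume a b := by
  obtain ⟨C, hC⟩ := hf.bddOn (max a b).toNNReal
  have hm : Measurable (fun s : ℝ => (f s.toNNReal : ℝ)) :=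
    (hf.measurable.comp measurable_real_toNNReal).coe_nnreal_real
  refine (intervalIntegrable_const (c := (C : ℝ))).mono_fun hm.aestronglyMeasurable ?_
  refine (ae_restrict_iff' measurableSet_uIoc).2 (.of_forall fun s hs => ?_)
  have : s ≤ max a b := hs.2
  simpa using hC _ (Real.toNNReal_le_toNNReal this)

theorem measurable_uncurry_real {Ω : Type*} [MeasurableSpace Ω] {X : ℝ≥0 → Ω → ℝ≥0}
    (hX : ∀ t, Measurable (X t)) (hc : ∀ ω, IsCadlag fun s => X s ω) :
    Measurable (fun q : Ω × ℝ => (X q.2.toNNReal q.1 : ℝ)) :=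
  ((measurable_uncurry_of_rightCont hX fun ω t => (hc ω t).1).comp
    ((measurable_real_toNNReal.comp measurable_snd).prodMk measurable_fst)).coe_nnreal_real

/-! ### Work, survival and arrivals along a path -/

section Paths

variable {E : Type*} {lam kap mu : E → ℝ≥0}

theorem coe_cumulativeRate (lam : E → ℝ≥0) (f : ℝ≥0 → E) (t : ℝ≥0) :
    (cumulativeRate lam f t : ℝ) = ∫ s in (0 : ℝ)..t, (lam (f s.toNNReal) : ℝ) := rfl

theorem workDone_of_le {f : ℝ≥0 → E} {s t : ℝ≥0} (hst : s ≤ t) :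
    workDone mu f s t = ∫ r in (s : ℝ)..t, (mu (f r.toNNReal) : ℝ) := by
  rw [workDone, integral_Ico_eq_integral_Ioo, ← integral_Ioc_eq_integral_Ioo,
    intervalIntegral.integral_of_le (NNReal.coe_le_coe.2 hst)]

theorem workDone_nonneg (mu : E → ℝ≥0) (f : ℝ≥0 → E) (s t : ℝ≥0) : 0 ≤ workDone mu f s t :=
  integral_nonneg fun _ => NNReal.coe_nonneg _

/-- The probability that a job entering at time `s` is still present at time `t`. -/
def survival (kap mu : E → ℝ≥0) (f : ℝ≥0 → E) (t s : ℝ≥0) : ℝ :=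
  Real.exp (-(kap (f s) : ℝ) * workDone mu f s t)

theorem survival_nonneg (f : ℝ≥0 → E) (t s : ℝ≥0) : 0 ≤ survival kap mu f t s := Real.exp_nonneg _

theorem survival_le_one (f : ℝ≥0 → E) (t s : ℝ≥0) : survival kap mu f t s ≤ 1 := by
  rw [survival, Real.exp_le_one_iff, neg_mul, neg_nonpos]
  exact mul_nonneg (NNReal.coe_nonneg _) (workDone_nonneg _ _ _ _)

theorem coe_poissonParameter (f : ℝ≥0 → E) (t : ℝ≥0) :
    (poissonParameter lam kap mu t f : ℝ) =
      ∫ s in (0 : ℝ)..t, (lam (f s.toNNReal) : ℝ) * survival kap mu f t s.toNNReal := by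
  change ∫ s in (0 : ℝ)..t, _ = _
  refine intervalIntegral.integral_congr fun s hs => ?_
  rw [uIcc_of_le (NNReal.coe_nonneg t)] at hs
  have h : s.toNNReal ≤ t := Real.toNNReal_le_iff_le_coe.2 hs.2
  simp only [survival, workDone_of_le h, Real.coe_toNNReal _ hs.1]

variable [TopologicalSpace E]

/-! ### The cumulative rate and the arrival path -/

theorem continuous_cumulativeRate (hlam : Continuous lam) {f : ℝ≥0 → E} (hf : IsCadlag f) :
    Continuous (cumulativeRate lam f) := by
  rw [NNReal.isEmbedding_coe.continuous_iff]
  exact (intervalIntegral.continuous_primitive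
    (fun a b => (hf.comp hlam).intervalIntegrable a b) 0).comp NNReal.continuous_coe

theorem cumulativeRate_sub (hlam : Continuous lam) {f : ℝ≥0 → E} (hf : IsCadlag f) (s t : ℝ≥0) :
    (cumulativeRate lam f t : ℝ) - cumulativeRate lam f s =
      ∫ r in (s : ℝ)..t, (lam (f r.toNNReal) : ℝ) := by
  rw [coe_cumulativeRate, coe_cumulativeRate, intervalIntegral.integral_interval_sub_left]
  all_goals exact (hf.comp hlam).intervalIntegrable _ _

theorem monotone_cumulativeRate (hlam : Continuous lam) {f : ℝ≥0 → E} (hf : IsCadlag f) :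
    Monotone (cumulativeRate lam f) := by
  intro s t hst
  have h := cumulativeRate_sub hlam hf s t
  have h2 : 0 ≤ ∫ r in (s : ℝ)..t, (lam (f r.toNNReal) : ℝ) :=
    intervalIntegral.integral_nonneg hst fun _ _ => NNReal.coe_nonneg _
  rw [← NNReal.coe_le_coe]
  linarith

/-- A counting path: it starts at `0`, is nondecreasing and right-continuous. -/
structure IsCountingPath (Y : ℝ≥0 → ℕ) : Prop where
  zero : Y 0 = 0
  mono : Monotone Y
  rightCont : ∀ t, ContinuousWithinAt Y (Ici t) t

theorem IsStandardPoissonProcess.isCountingPath {Ω : Type*} [MeasurableSpace Ω]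
    {N : ℝ≥0 → Ω → ℕ} {P : Measure Ω} (hN : IsStandardPoissonProcess N P) (ω : Ω) :
    IsCountingPath fun s => N s ω := ⟨hN.zero ω, hN.mono ω, hN.rightCont ω⟩

theorem IsCountingPath.comp_cumulativeRate {Y : ℝ≥0 → ℕ} (hY : IsCountingPath Y) (hlam : Continuous lam)
    {f : ℝ≥0 → E} (hf : IsCadlag f) : IsCountingPath (arrivals lam f Y) where
  zero := by
    have : cumulativeRate lam f 0 = 0 := NNReal.coe_injective (by simp [coe_cumulativeRate])
    rw [arrivals, this, hY.zero]
  mono := hY.mono.comp (monotone_cumulativeRate hlam hf)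
  rightCont t := (hY.rightCont _).comp (continuous_cumulativeRate hlam hf).continuousWithinAt
    fun _ hs => monotone_cumulativeRate hlam hf hs

/-- Right-continuity is what makes the infimum attained: if `Y t < k`, then `Y` stays below `k` on
some `[t, u)`, so the jump time is at least `u > t`. -/
theorem IsCountingPath.jumpTime_le_iff {Y : ℝ≥0 → ℕ} (hY : IsCountingPath Y) {k : ℕ} {t : ℝ≥0} :
    jumpTime Y k ≤ t ↔ k ≤ Y t := by
  refine ⟨fun h => ?_, fun h => iInf₂_le t h⟩
  by_contra! hk
  have h1 : ∀ᶠ s in 𝓝[≥] t, Y s < k := (hY.rightCont t).eventually_lt_const hk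
  obtain ⟨u, htu, hu⟩ := (mem_nhdsGE_iff_exists_Ico_subset).1 h1
  have h2 : (u : ℝ≥0∞) ≤ jumpTime Y k := by
    refine le_iInf₂ fun s hs => ?_
    by_contra! hsu
    rw [ENNReal.coe_lt_coe] at hsu
    rcases le_total t s with hts | hts
    · exact absurd hs (not_le.2 (hu ⟨hts, hsu⟩))
    · exact absurd (hs.trans (hY.mono hts)) (not_le.2 hk)
  exact absurd (h2.trans h) (not_le.2 (ENNReal.coe_lt_coe.2 htu))

theorem IsCountingPath.hasEntered_iff {Y : ℝ≥0 → ℕ} (hY : IsCountingPath Y)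
    (hlam : Continuous lam) {f : ℝ≥0 → E} (hf : IsCadlag f) {k : ℕ} {t : ℝ≥0} :
    HasEntered lam f Y t k ↔ k ≤ arrivals lam f Y t :=
  (hY.comp_cumulativeRate hlam hf).jumpTime_le_iff

theorem IsCountingPath.finite_hasEntered {Y : ℝ≥0 → ℕ} (hY : IsCountingPath Y)
    (hlam : Continuous lam) {f : ℝ≥0 → E} (hf : IsCadlag f) (t : ℝ≥0) :
    {k : ℕ | 1 ≤ k ∧ HasEntered lam f Y t k}.Finite :=
  (finite_Iic (arrivals lam f Y t)).subset fun _ hk => (hY.hasEntered_iff hlam hf).1 hk.2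

/-! ### The number of jobs as a finite sum -/

/-- The time at which job `k + 1` arrives, as a nonnegative real number. -/
def entryTime (lam : E → ℝ≥0) (f : ℝ≥0 → E) (Y : ℝ≥0 → ℕ) (k : ℕ) : ℝ≥0 :=
  (arrivalTime lam f Y (k + 1)).toNNReal

/-- A job that enters at time `s` with exponential draw `z` has been served by time `t`. -/
def Served (kap mu : E → ℝ≥0) (f : ℝ≥0 → E) (t s : ℝ≥0) (z : ℝ) : Prop :=
  serviceRequirement kap (f s) z ≤ ((workDone mu f s t : ℝ) : EReal)

-- A job that has left has entered, so the truncated subtraction in `ℕ` loses nothing; terms beyond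
-- the number of arrivals vanish, so the `tsum` is a genuine finite sum.
open Classical in
theorem IsCountingPath.numJobs_eq {Y : ℝ≥0 → ℕ} (hY : IsCountingPath Y)
    (hlam : Continuous lam) {f : ℝ≥0 → E} (hf : IsCadlag f) (Z : ℕ → ℝ) (t : ℝ≥0) :
    numJobs lam kap mu f Y Z t = ∑ k ∈ Finset.range (arrivals lam f Y t),
      if Served kap mu f t (entryTime lam f Y k) (Z (k + 1)) then 0 else 1 := by
  rw [numJobs, tsum_eq_sum (s := Finset.range (arrivals lam f Y t))]
  · refine Finset.sum_congr rfl fun k hk => ?_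
    have hE : HasEntered lam f Y t (k + 1) :=
      (hY.hasEntered_iff hlam hf).2 (Finset.mem_range.1 hk)
    have hL : HasLeft lam kap mu f Y Z t (k + 1) ↔
        Served kap mu f t (entryTime lam f Y k) (Z (k + 1)) := and_iff_right hE
    rw [if_pos hE]
    by_cases h : Served kap mu f t (entryTime lam f Y k) (Z (k + 1)) <;> simp [hL, h]
  · intro k hk
    have hE : ¬ HasEntered lam f Y t (k + 1) := fun h =>
      hk (Finset.mem_range.2 ((hY.hasEntered_iff hlam hf).1 h))
    simp [hE]

/-- The hypothesis `hk` rules out an infinite arrival time, which `toNNReal` would send to `0`. -/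
theorem IsCountingPath.entryTime_le_iff {Y : ℝ≥0 → ℕ} (hY : IsCountingPath Y)
    (hlam : Continuous lam) {f : ℝ≥0 → E} (hf : IsCadlag f) {k : ℕ} {t : ℝ≥0}
    (hk : k < arrivals lam f Y t) (s : ℝ≥0) :
    entryTime lam f Y k ≤ s ↔ k < arrivals lam f Y s := by
  have hfin : arrivalTime lam f Y (k + 1) ≠ ∞ :=
    (((hY.hasEntered_iff hlam hf).2 hk : arrivalTime lam f Y (k + 1) ≤ t).trans_lt
      ENNReal.coe_lt_top).ne
  have h := hY.hasEntered_iff hlam hf (k := k + 1) (t := s)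
  rw [HasEntered, ← ENNReal.coe_toNNReal hfin, ENNReal.coe_le_coe] at h
  exact h

theorem continuous_workDone (hmu : Continuous mu) {f : ℝ≥0 → E} (hf : IsCadlag f) (t : ℝ≥0) :
    Continuous fun s => workDone mu f s t := by
  -- For `s > t` the interval of work is empty; `min s t` covers both cases by one continuous
  -- formula.
  have : (fun s => workDone mu f s t) = fun s =>
      (cumulativeRate mu f t : ℝ) - cumulativeRate mu f (min s t) := by
    ext s
    rcases le_total s t with h | h
    · rw [workDone_of_le h, min_eq_left h, cumulativeRate_sub hmu hf]
    · rw [min_eq_right h, workDone, Ico_eq_empty (by simpa using h)]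
      simp
  rw [this]
  exact continuous_const.sub (NNReal.continuous_coe.comp
    ((continuous_cumulativeRate hmu hf).comp (continuous_id.min continuous_const)))

theorem rightCont_survival (hkap : Continuous kap) (hmu : Continuous mu) {f : ℝ≥0 → E}
    (hf : IsCadlag f) (t s : ℝ≥0) : ContinuousWithinAt (survival kap mu f t) (Ici s) s :=
  Real.continuous_exp.continuousAt.comp_continuousWithinAt
    ((NNReal.continuous_coe.continuousAt.comp_continuousWithinAt ((hf.comp hkap) s).1).neg.mul
      (continuous_workDone hmu hf t).continuousWithinAt)

/-! ### Measurability in the randomness -/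

variable {Ω : Type*} [MeasurableSpace Ω] [MeasurableSpace E] [BorelSpace E]
  {J : ℝ≥0 → Ω → E} {Y : ℝ≥0 → Ω → ℕ} {Z : ℕ → Ω → ℝ}

theorem measurable_comp_path (hlam : Continuous lam) (hJ : ∀ s, Measurable (J s))
    (hc : ∀ ω, IsCadlag fun s => J s ω) :
    Measurable (fun q : Ω × ℝ => (lam (J q.2.toNNReal q.1) : ℝ)) :=
  measurable_uncurry_real (X := fun s ω => lam (J s ω)) (fun s => hlam.measurable.comp (hJ s))
    fun ω => (hc ω).comp hlam

theorem measurable_comp_path_at (hlam : Continuous lam) (hJ : ∀ s, Measurable (J s))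
    (hc : ∀ ω, IsCadlag fun s => J s ω) {T : Ω → ℝ≥0} (hT : Measurable T) :
    Measurable (fun ω => lam (J (T ω) ω)) :=
  (measurable_uncurry_of_rightCont (X := fun s ω => lam (J s ω))
    (fun s => hlam.measurable.comp (hJ s)) fun ω t => ((hc ω).comp hlam t).1).comp
      (hT.prodMk measurable_id)

theorem measurable_cumulativeRate (hlam : Continuous lam) (hJ : ∀ s, Measurable (J s))
    (hc : ∀ ω, IsCadlag fun s => J s ω) (t : ℝ≥0) :
    Measurable fun ω => cumulativeRate lam (fun s => J s ω) t := by
  refine Measurable.subtype_mk ?_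
  simp_rw [intervalIntegral.integral_of_le (NNReal.coe_nonneg t)]
  exact ((measurable_comp_path hlam hJ hc).stronglyMeasurable.integral_prod_right'
    (ν := volume.restrict (Ioc (0 : ℝ) t))).measurable

theorem measurable_workDone (hmu : Continuous mu) (hJ : ∀ s, Measurable (J s))
    (hc : ∀ ω, IsCadlag fun s => J s ω) (t : ℝ≥0) {T : Ω → ℝ≥0} (hT : Measurable T) :
    Measurable fun ω => workDone mu (fun s => J s ω) (T ω) t := by
  have h := measurable_uncurry_of_rightCont
    (X := fun s ω => workDone mu (fun s => J s ω) s t) (fun s => ?_)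
    (fun ω s => (continuous_workDone hmu (hc ω) t).continuousWithinAt)
  · exact h.comp (hT.prodMk measurable_id)
  · exact ((measurable_comp_path hmu hJ hc).stronglyMeasurable.integral_prod_right'
      (ν := volume.restrict (Ico (s : ℝ) t))).measurable

theorem measurable_survival (hkap : Continuous kap) (hmu : Continuous mu)
    (hJ : ∀ s, Measurable (J s)) (hc : ∀ ω, IsCadlag fun s => J s ω) (t s : ℝ≥0) :
    Measurable fun ω => survival kap mu (fun s => J s ω) t s :=
  Real.measurable_exp.comp ((hkap.measurable.comp (hJ s)).coe_nnreal_real.neg.mul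
    (measurable_workDone hmu hJ hc t measurable_const))

theorem measurable_poissonParameter (hlam : Continuous lam) (hkap : Continuous kap)
    (hmu : Continuous mu) (hJ : ∀ s, Measurable (J s)) (hc : ∀ ω, IsCadlag fun s => J s ω)
    (t : ℝ≥0) : Measurable fun ω => poissonParameter lam kap mu t (fun s => J s ω) := by
  have hs : Measurable (fun q : Ω × ℝ => survival kap mu (fun s => J s q.1) t q.2.toNNReal) :=
    (measurable_uncurry_of_rightCont (fun s => measurable_survival hkap hmu hJ hc t s)
      (fun ω s => rightCont_survival hkap hmu (hc ω) t s)).comp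
      ((measurable_real_toNNReal.comp measurable_snd).prodMk measurable_fst)
  have h : Measurable fun ω => (poissonParameter lam kap mu t (fun s => J s ω) : ℝ) := by
    simp_rw [coe_poissonParameter, intervalIntegral.integral_of_le (NNReal.coe_nonneg t)]
    exact (((measurable_comp_path hlam hJ hc).mul hs).stronglyMeasurable.integral_prod_right'
      (ν := volume.restrict (Ioc (0 : ℝ) t))).measurable
  simpa using h.real_toNNReal

theorem measurable_arrivals (hlam : Continuous lam) (hJ : ∀ s, Measurable (J s))
    (hc : ∀ ω, IsCadlag fun s => J s ω) (hY : ∀ s, Measurable (Y s))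
    (hYc : ∀ ω, IsCountingPath fun s => Y s ω) (t : ℝ≥0) :
    Measurable fun ω => arrivals lam (fun s => J s ω) (fun s => Y s ω) t :=
  (measurable_uncurry_of_rightCont hY fun ω => (hYc ω).rightCont).comp
    ((measurable_cumulativeRate hlam hJ hc t).prodMk measurable_id)

theorem measurable_entryTime (hlam : Continuous lam) (hJ : ∀ s, Measurable (J s))
    (hc : ∀ ω, IsCadlag fun s => J s ω) (hY : ∀ s, Measurable (Y s))
    (hYc : ∀ ω, IsCountingPath fun s => Y s ω) (k : ℕ) :
    Measurable fun ω => entryTime lam (fun s => J s ω) (fun s => Y s ω) k := by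
  refine ENNReal.measurable_toNNReal.comp (measurable_of_Iic fun x => ?_)
  induction x with
  | top => simp
  | coe s =>
    have : (fun ω => arrivalTime lam (fun s => J s ω) (fun s => Y s ω) (k + 1)) ⁻¹' Iic (s : ℝ≥0∞)
        = {ω | k + 1 ≤ arrivals lam (fun s => J s ω) (fun s => Y s ω) s} := by
      ext ω
      exact (hYc ω).hasEntered_iff hlam (hc ω)
    rw [this]
    exact measurableSet_le measurable_const (measurable_arrivals hlam hJ hc hY hYc s)

theorem measurableSet_served (hkap : Continuous kap) (hmu : Continuous mu)
    (hJ : ∀ s, Measurable (J s)) (hc : ∀ ω, IsCadlag fun s => J s ω) (t : ℝ≥0)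
    {T : Ω → ℝ≥0} (hT : Measurable T) {z : Ω → ℝ} (hz : Measurable z) :
    MeasurableSet {ω | Served kap mu (fun s => J s ω) t (T ω) (z ω)} := by
  have hk := measurable_comp_path_at hkap hJ hc hT
  have hw := measurable_workDone hmu hJ hc t hT
  have : {ω | Served kap mu (fun s => J s ω) t (T ω) (z ω)} = {ω | 0 < kap (J (T ω) ω)} ∩
      {ω | z ω / kap (J (T ω) ω) ≤ workDone mu (fun s => J s ω) (T ω) t} := by
    ext ω
    by_cases h : 0 < kap (J (T ω) ω)
    · simp [Served, serviceRequirement, h]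
    · simp [Served, serviceRequirement, h]
  rw [this]
  exact (measurableSet_lt measurable_const hk).inter
    (measurableSet_le (hz.div hk.coe_nnreal_real) hw)

theorem measurable_numJobs (hlam : Continuous lam) (hkap : Continuous kap)
    (hmu : Continuous mu) (hJ : ∀ s, Measurable (J s)) (hc : ∀ ω, IsCadlag fun s => J s ω)
    (hY : ∀ s, Measurable (Y s)) (hYc : ∀ ω, IsCountingPath fun s => Y s ω)
    (hZ : ∀ k, Measurable (Z k)) (t : ℝ≥0) :
    Measurable fun ω =>
      numJobs lam kap mu (fun s => J s ω) (fun s => Y s ω) (fun k => Z k ω) t := by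
  classical
  have h : Measurable (fun q : ℕ × Ω => ∑ k ∈ Finset.range q.1,
      if Served kap mu (fun s => J s q.2) t (entryTime lam (fun s => J s q.2) (fun s => Y s q.2) k)
        (Z (k + 1) q.2) then 0 else 1) :=
    measurable_from_prod_countable_right fun n =>
    Finset.measurable_fun_sum (Finset.range n) fun k _ =>
      Measurable.ite (measurableSet_served hkap hmu hJ hc t
        (measurable_entryTime hlam hJ hc hY hYc k) (hZ (k + 1))) measurable_const measurable_const
  have h2 := h.comp ((measurable_arrivals hlam hJ hc hY hYc t).prodMk measurable_id)
  convert h2 using 2 with ω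
  exact (hYc ω).numJobs_eq hlam (hc ω) _ t

end Paths

/-! ### Auxiliary facts on measurability, independence and the Poisson distribution -/

theorem measurable_prod_range_random {Ω M : Type*} [MeasurableSpace Ω] [CommMonoid M]
    [MeasurableSpace M] [MeasurableMul₂ M] {n : Ω → ℕ} (hn : Measurable n) {F : ℕ → Ω → M}
    (hF : ∀ k, Measurable (F k)) : Measurable fun ω => ∏ k ∈ Finset.range (n ω), F k ω := by
  have h : Measurable (fun q : ℕ × Ω => ∏ k ∈ Finset.range q.1, F k q.2) :=
    measurable_from_prod_countable_right fun m =>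
      Finset.measurable_fun_prod (Finset.range m) fun k _ => hF k
  exact h.comp (hn.prodMk measurable_id)

/-- This allows Fubini on `Ω × Ω` with two generated σ-algebras instead of on path spaces. There
every point still carries a càdlàg or counting path, whereas the product space also contains
irregular paths. -/
theorem indepFun_id_id_of_indep {Ω : Type*} {m₁ m₂ mΩ : MeasurableSpace Ω} {P : Measure[mΩ] Ω}
    (h : Indep m₁ m₂ P) : @IndepFun Ω Ω Ω mΩ m₁ m₂ id id P := by
  rw [@IndepFun_iff_Indep Ω Ω Ω mΩ m₁ m₂, MeasurableSpace.comap_id, MeasurableSpace.comap_id]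
  exact h

theorem integral_comp_prodMk_of_indepFun {Ω Ω₁ Ω₂ : Type*} [MeasurableSpace Ω]
    [MeasurableSpace Ω₁] [MeasurableSpace Ω₂] {P : Measure Ω} [IsProbabilityMeasure P]
    {X : Ω → Ω₁} {W : Ω → Ω₂} (hX : Measurable X) (hW : Measurable W) (hXW : IndepFun X W P)
    {G : Ω₁ → Ω₂ → ℂ} (hG : Measurable (fun q : Ω₁ × Ω₂ => G q.1 q.2)) {C : ℝ}
    (hC : ∀ x w, ‖G x w‖ ≤ C) :
    ∫ ω, G (X ω) (W ω) ∂P = ∫ ω, ∫ ω', G (X ω) (W ω') ∂P ∂P := by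
  have := Measure.isProbabilityMeasure_map (μ := P) hX.aemeasurable
  have := Measure.isProbabilityMeasure_map (μ := P) hW.aemeasurable
  have hint : Integrable (fun q : Ω₁ × Ω₂ => G q.1 q.2) ((P.map X).prod (P.map W)) :=
    Integrable.of_bound hG.aestronglyMeasurable C (.of_forall fun q => hC q.1 q.2)
  calc ∫ ω, G (X ω) (W ω) ∂P
      = ∫ q, G q.1 q.2 ∂(P.map fun ω => (X ω, W ω)) :=
        (integral_map (hX.prodMk hW).aemeasurable hG.aestronglyMeasurable).symm
    _ = ∫ x, ∫ w, G x w ∂(P.map W) ∂(P.map X) := by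
        rw [hXW.map_prod_eq_prod_map_map hX.aemeasurable hW.aemeasurable, integral_prod _ hint]
    _ = ∫ ω, ∫ w, G (X ω) w ∂(P.map W) ∂P :=
        integral_map hX.aemeasurable
          hG.stronglyMeasurable.integral_prod_right'.aestronglyMeasurable
    _ = _ := by
        congr with ω
        exact integral_map hW.aemeasurable
          (hG.comp (measurable_const.prodMk measurable_id)).aestronglyMeasurable

theorem integral_pow_poissonMeasure (r : ℝ≥0) (z : ℂ) :
    ∫ n, z ^ n ∂(poissonMeasure r) = Complex.exp (r * (z - 1)) := by
  rw [integral_poissonMeasure r]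
  calc ∑' n : ℕ, (Real.exp (-r) * r ^ n / n.factorial) • z ^ n
      = ∑' n : ℕ, (Real.exp (-r) : ℂ) * ((r * z) ^ n / n.factorial) := by
        congr with n
        rw [Complex.real_smul, mul_pow]
        push_cast
        ring
    _ = Real.exp (-r) * Complex.exp (r * z) := by
        rw [tsum_mul_left, (NormedSpace.expSeries_div_hasSum_exp ((r : ℂ) * z)).tsum_eq,
          Complex.exp_eq_exp_ℂ]
    _ = Complex.exp (r * (z - 1)) := by
        rw [Complex.ofReal_exp, ← Complex.exp_add]
        push_cast
        ring_nf

/-! ### Multiplicative functionals of the arrival process along a fixed path -/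

section FixedPath

variable {E : Type*} {lam kap mu : E → ℝ≥0} {f : ℝ≥0 → E}
  {Ω : Type*} [MeasurableSpace Ω] {P : Measure Ω} {Y : ℝ≥0 → Ω → ℕ}

theorem measureReal_served {Z : Ω → ℝ} (hZ : HasLaw Z (expMeasure 1) P) (t s : ℝ≥0) :
    P.real {ω | Served kap mu f t s (Z ω)} = 1 - survival kap mu f t s := by
  -- If `κ` vanishes, the requirement is `⊤`: the job is never served and its survival probability
  -- is `1`.
  rcases eq_zero_or_pos (kap (f s)) with hk | hk
  · simp [Served, serviceRequirement, survival, hk]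
  have := isProbabilityMeasure_expMeasure one_pos
  have hx : 0 ≤ workDone mu f s t * kap (f s) :=
    mul_nonneg (workDone_nonneg _ _ _ _) (NNReal.coe_nonneg _)
  have hset : {ω | Served kap mu f t s (Z ω)} = {ω | Z ω ≤ workDone mu f s t * kap (f s)} := by
    ext ω
    simp [Served, serviceRequirement, hk, div_le_iff₀]
  rw [hset, hZ.measureReal_eq (p := fun x => x ≤ workDone mu f s t * kap (f s)) measurableSet_Iic]
  change (expMeasure 1).real (Iic _) = _
  rw [← cdf_eq_real, cdf_expMeasure_eq one_pos, if_pos hx, survival]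
  ring_nf

variable [TopologicalSpace E]

theorem intervalIntegrable_mul_of_bounded (hlam : Continuous lam) (hf : IsCadlag f) {G : ℝ≥0 → ℂ}
    (hG : Measurable G) {C : ℝ} (hC : ∀ s, ‖G s‖ ≤ C) (a b : ℝ) :
    IntervalIntegrable (fun s : ℝ => ((lam (f s.toNNReal) : ℝ) : ℂ) * G s.toNNReal)
      volume a b := by
  refine (((hf.comp hlam).intervalIntegrable a b).const_mul C).mono_fun ?_ ?_
  · exact ((Complex.measurable_ofReal.comp ((hf.comp hlam).measurable.comp
      measurable_real_toNNReal).coe_nnreal_real).mul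
        (hG.comp measurable_real_toNNReal)).aestronglyMeasurable
  · refine .of_forall fun s => ?_
    have hC0 : 0 ≤ C := (norm_nonneg _).trans (hC 0)
    simp only [norm_mul, Complex.norm_real, Real.norm_of_nonneg hC0]
    rw [mul_comm]
    gcongr
    exact hC _

/-- All jobs entering during the cell `(iδ, (i+1)δ]` are rounded to its right endpoint, and their
number is the increment of the arrival path. -/
theorem IsCountingPath.prod_ceilTo_entryTime {Y : ℝ≥0 → ℕ} (hY : IsCountingPath Y)
    (hlam : Continuous lam) (hf : IsCadlag f) {δ : ℝ≥0} (hδ : 0 < δ) (h : ℝ≥0 → ℂ) (m : ℕ) :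
    ∏ k ∈ Finset.range (arrivals lam f Y (m * δ)), h (ceilTo δ (entryTime lam f Y k)) =
      ∏ i ∈ Finset.range m, h ((i + 1 : ℕ) * δ) ^
        (arrivals lam f Y ((i + 1 : ℕ) * δ) - arrivals lam f Y (i * δ)) := by
  induction m with
  | zero => simp [(hY.comp_cumulativeRate hlam hf).zero]
  | succ m ih =>
    have hle : arrivals lam f Y (m * δ) ≤ arrivals lam f Y ((m + 1 : ℕ) * δ) :=
      (hY.comp_cumulativeRate hlam hf).mono (by gcongr; simp)
    rw [Finset.prod_range_succ, ← ih, ← Finset.prod_range_mul_prod_Ico _ hle]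
    congr 1
    rw [← Nat.card_Ico]
    refine Finset.prod_eq_pow_card fun k hk => ?_
    rw [Finset.mem_Ico] at hk
    have hiff := hY.entryTime_le_iff hlam hf hk.2
    rw [ceilTo_eq_of_mem_Ioc hδ (lt_of_not_ge fun h => not_lt.2 hk.1 ((hiff _).1 h))
      ((hiff _).2 hk.2)]

theorem sum_cumulativeRate_mul (hlam : Continuous lam) (hf : IsCadlag f) {δ : ℝ≥0} (hδ : 0 < δ)
    {G : ℝ≥0 → ℂ} (hG : Measurable G) {C : ℝ} (hC : ∀ s, ‖G s‖ ≤ C) (m : ℕ) :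
    ∑ i ∈ Finset.range m, ((cumulativeRate lam f ((i + 1 : ℕ) * δ) -
        cumulativeRate lam f (i * δ) : ℝ≥0) : ℂ) * G ((i + 1 : ℕ) * δ) =
      ∫ s in (0 : ℝ)..(m * δ : ℝ≥0),
        ((lam (f s.toNNReal) : ℝ) : ℂ) * G (ceilTo δ s.toNNReal) := by
  have hadj := intervalIntegral.sum_integral_adjacent_intervals (μ := volume)
    (f := fun s : ℝ => ((lam (f s.toNNReal) : ℝ) : ℂ) * G (ceilTo δ s.toNNReal))
    (a := fun i : ℕ => ((i * δ : ℝ≥0) : ℝ)) (n := m)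
    (fun i _ => intervalIntegrable_mul_of_bounded hlam hf (hG.comp (measurable_ceilTo δ))
      (fun s => hC _) _ _)
  have h0 : (((0 : ℕ) * δ : ℝ≥0) : ℝ) = 0 := by simp
  rw [h0] at hadj
  rw [← hadj]
  refine Finset.sum_congr rfl fun i _ => ?_
  have hle : (i : ℝ≥0) * δ ≤ (i + 1 : ℕ) * δ := by gcongr; simp
  have h1 : ∫ s in ((i * δ : ℝ≥0) : ℝ)..((i + 1 : ℕ) * δ : ℝ≥0),
      ((lam (f s.toNNReal) : ℝ) : ℂ) * G (ceilTo δ s.toNNReal) =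
      ∫ s in ((i * δ : ℝ≥0) : ℝ)..((i + 1 : ℕ) * δ : ℝ≥0),
      ((lam (f s.toNNReal) : ℝ) : ℂ) * G ((i + 1 : ℕ) * δ) := by
    refine intervalIntegral.integral_congr_ae (.of_forall fun s hs => ?_)
    rw [uIoc_of_le (NNReal.coe_le_coe.2 hle)] at hs
    rw [ceilTo_eq_of_mem_Ioc hδ (Real.lt_toNNReal_iff_coe_lt.2 hs.1)
      (Real.toNNReal_le_iff_le_coe.2 hs.2)]
  rw [h1, intervalIntegral.integral_mul_const, intervalIntegral.integral_ofReal,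
    ← cumulativeRate_sub hlam hf, ← NNReal.coe_sub (monotone_cumulativeRate hlam hf hle)]

/-- Independence of the increments over the cells factors the expectation into Poisson generating
functions, whose exponents add up to the integral of the rounded integrand. -/
theorem integral_prod_ceilTo_entryTime (hY : IsStandardPoissonProcess Y P)
    (hlam : Continuous lam) (hf : IsCadlag f) {δ : ℝ≥0} (hδ : 0 < δ) {h : ℝ≥0 → ℂ}
    (hm : Measurable h) (h1 : ∀ s, ‖h s‖ ≤ 1) (m : ℕ) :
    ∫ ω, ∏ k ∈ Finset.range (arrivals lam f (fun s => Y s ω) (m * δ)),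
        h (ceilTo δ (entryTime lam f (fun s => Y s ω) k)) ∂P =
      Complex.exp (∫ s in (0 : ℝ)..(m * δ : ℝ≥0),
        ((lam (f s.toNNReal) : ℝ) : ℂ) * (h (ceilTo δ s.toNNReal) - 1)) := by
  have hmono : Monotone fun i : ℕ => cumulativeRate lam f (i * δ) := fun i j hij =>
    monotone_cumulativeRate hlam hf (by gcongr)
  simp_rw [fun ω => (hY.isCountingPath ω).prod_ceilTo_entryTime hlam hf hδ h m,
    Finset.prod_range]
  have hind := hY.indepIncrements m (fun i => cumulativeRate lam f ((i : ℕ) * δ))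
    (fun i j hij => hmono hij)
  have hprod := hind.integral_fun_prod_comp (𝕜 := ℂ)
    (f := fun (i : Fin m) (n : ℕ) => h ((i + 1 : ℕ) * δ) ^ n)
    (fun i => ((hY.measurable _).sub (hY.measurable _)).aemeasurable)
    (fun i => (measurable_from_nat).aestronglyMeasurable)
  refine hprod.trans ?_
  rw [← sum_cumulativeRate_mul hlam hf hδ (hm.sub_const 1) (C := 2)
    (fun s => (norm_sub_le _ _).trans (by have := h1 s; simp; linarith)) m, Finset.sum_range,
    Complex.exp_sum]
  refine Finset.prod_congr rfl fun i _ => ?_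
  have hl := (hY.law_increment _ _ (hmono (Nat.le_succ i))).integral_comp
    (f := fun n : ℕ => h ((i + 1 : ℕ) * δ) ^ n) (measurable_from_nat).aestronglyMeasurable
  exact hl.trans (integral_pow_poissonMeasure _ _)

variable [IsProbabilityMeasure P] [MeasurableSpace E] [BorelSpace E]

theorem integral_prod_entryTime (hY : IsStandardPoissonProcess Y P)
    (hlam : Continuous lam) (hf : IsCadlag f) {h : ℝ≥0 → ℂ}
    (hc : ∀ s, ContinuousWithinAt h (Ici s) s) (h1 : ∀ s, ‖h s‖ ≤ 1) (t : ℝ≥0) :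
    ∫ ω, ∏ k ∈ Finset.range (arrivals lam f (fun s => Y s ω) t),
        h (entryTime lam f (fun s => Y s ω) k) ∂P =
      Complex.exp (∫ s in (0 : ℝ)..t,
        ((lam (f s.toNNReal) : ℝ) : ℂ) * (h s.toNNReal - 1)) := by
  rcases eq_zero_or_pos t with rfl | ht
  · simp [fun ω => ((hY.isCountingPath ω).comp_cumulativeRate hlam hf).zero]
  have hm : Measurable h := measurable_of_rightCont hc
  have hent (k : ℕ) : Measurable fun ω => entryTime lam f (fun s => Y s ω) k :=
    measurable_entryTime (J := fun s _ => f s) hlam (fun s => measurable_const) (fun _ => hf)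
      hY.measurable hY.isCountingPath k
  have harr : Measurable fun ω => arrivals lam f (fun s => Y s ω) t := hY.measurable _
  have hL : Tendsto (fun n : ℕ => ∫ ω, ∏ k ∈ Finset.range (arrivals lam f (fun s => Y s ω) t),
      h (ceilTo (t / (n + 1)) (entryTime lam f (fun s => Y s ω) k)) ∂P) atTop
      (𝓝 (∫ ω, ∏ k ∈ Finset.range (arrivals lam f (fun s => Y s ω) t),
        h (entryTime lam f (fun s => Y s ω) k) ∂P)) := by
    refine tendsto_integral_of_dominated_convergence (fun _ => 1) (fun n => ?_)
      (integrable_const _) (fun n => .of_forall fun ω => ?_) (.of_forall fun ω => ?_)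
    · exact (measurable_prod_range_random harr fun k =>
        hm.comp ((measurable_ceilTo _).comp (hent k))).aestronglyMeasurable
    · rw [norm_prod]
      exact Finset.prod_le_one (fun _ _ => norm_nonneg _) fun _ _ => h1 _
    · exact tendsto_finsetProd _ fun k _ => (hc _).tendsto.comp (tendsto_ceilTo ht _)
  have hR : Tendsto (fun n : ℕ => ∫ s in (0 : ℝ)..t, ((lam (f s.toNNReal) : ℝ) : ℂ) *
      (h (ceilTo (t / (n + 1)) s.toNNReal) - 1)) atTop
      (𝓝 (∫ s in (0 : ℝ)..t, ((lam (f s.toNNReal) : ℝ) : ℂ) * (h s.toNNReal - 1))) := by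
    have h2 (s : ℝ≥0) : ‖h s - 1‖ ≤ 2 :=
      (norm_sub_le _ _).trans (by have := h1 s; simp; linarith)
    refine intervalIntegral.tendsto_integral_filter_of_dominated_convergence
      (fun s => (lam (f s.toNNReal) : ℝ) * 2) (.of_forall fun n => ?_)
      (.of_forall fun n => .of_forall fun s _ => ?_)
      (((hf.comp hlam).intervalIntegrable _ _).mul_const 2) (.of_forall fun s _ => ?_)
    · exact ((Complex.measurable_ofReal.comp ((hf.comp hlam).measurable.comp
        measurable_real_toNNReal).coe_nnreal_real).mul (((hm.comp (measurable_ceilTo _)).comp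
          measurable_real_toNNReal).sub_const 1)).aestronglyMeasurable
    · rw [norm_mul, Complex.norm_real, Real.norm_of_nonneg (NNReal.coe_nonneg _)]
      gcongr
      exact h2 _
    · exact (((hc _).tendsto.comp (tendsto_ceilTo ht _)).sub_const 1).const_mul _
  refine tendsto_nhds_unique hL ((hR.cexp).congr fun n => ?_)
  -- The mesh divides `t`, so `t` is itself a grid point and the formula for grid endpoints applies
  -- exactly.
  have hδ : 0 < t / ((n : ℝ≥0) + 1) := by positivity
  have ht' : ((n + 1 : ℕ) : ℝ≥0) * (t / (n + 1)) = t := by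
    push_cast
    field_simp
  have := integral_prod_ceilTo_entryTime hY hlam hf hδ hm h1 (n + 1)
  rw [ht'] at this
  exact this.symm

/-! ### Service -/

open Classical in
theorem integral_served (hkap : Continuous kap) (hmu : Continuous mu) (hf : IsCadlag f)
    {Z : Ω → ℝ} (hZm : Measurable Z) (hZ : HasLaw Z (expMeasure 1) P) (u : ℂ) (t s : ℝ≥0) :
    ∫ ω, (if Served kap mu f t s (Z ω) then 1 else u) ∂P =
      1 + (u - 1) * (survival kap mu f t s : ℂ) := by
  have hS : MeasurableSet {ω | Served kap mu f t s (Z ω)} :=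
    measurableSet_served (J := fun s _ => f s) (T := fun _ => s) hkap hmu
      (fun s => measurable_const) (fun _ => hf) t measurable_const hZm
  have h : ∀ ω, (if Served kap mu f t s (Z ω) then 1 else u) =
      u + {ω | Served kap mu f t s (Z ω)}.indicator (fun _ => 1 - u) ω := by
    intro ω
    by_cases hω : Served kap mu f t s (Z ω) <;> simp [hω]
  simp_rw [h]
  rw [integral_add (integrable_const _) ((integrable_const _).indicator hS),
    integral_indicator_const _ hS, measureReal_served hZ]
  simp only [integral_const, probReal_univ, one_smul, Complex.real_smul]
  push_cast
  ring

open Classical in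
theorem integral_prod_served (hkap : Continuous kap) (hmu : Continuous mu) (hf : IsCadlag f)
    {Z : ℕ → Ω → ℝ} (hZm : ∀ k, Measurable (Z k)) (hZ : ∀ k, HasLaw (Z k) (expMeasure 1) P)
    (hZi : iIndepFun Z P) (u : ℂ) (t : ℝ≥0) (s : ℕ → ℝ≥0) (n : ℕ) :
    ∫ ω, ∏ k ∈ Finset.range n, (if Served kap mu f t (s k) (Z (k + 1) ω) then 1 else u) ∂P =
      ∏ k ∈ Finset.range n, (1 + (u - 1) * (survival kap mu f t (s k) : ℂ)) := by
  simp_rw [Finset.prod_range]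
  -- Jobs are numbered from `1` while `range` starts at `0`, hence the shifted subfamily of draws.
  have hinj : Function.Injective fun k : Fin n => (k : ℕ) + 1 := fun i j hij => by
    simpa [Fin.ext_iff] using hij
  have hS (k : Fin n) : MeasurableSet {z | Served kap mu f t (s k) z} :=
    measurableSet_served (J := fun s _ => f s) (T := fun _ => s k) hkap hmu
      (fun s => measurable_const) (fun _ => hf) t measurable_const measurable_id
  have := (hZi.precomp hinj).integral_fun_prod_comp (𝕜 := ℂ)
    (f := fun (k : Fin n) (z : ℝ) => if Served kap mu f t (s k) z then 1 else u)
    (fun k => (hZm _).aemeasurable)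
    (fun k => (Measurable.ite (hS k) measurable_const measurable_const).aestronglyMeasurable)
  refine this.trans (Finset.prod_congr rfl fun k _ => ?_)
  exact integral_served hkap hmu hf (hZm _) (hZ _) u t _

/-- The number is a convex combination of `1` and `u`. -/
theorem norm_one_add_sub_one_mul_le {u : ℂ} (hu : ‖u‖ = 1) {p : ℝ} (h0 : 0 ≤ p) (h1 : p ≤ 1) :
    ‖1 + (u - 1) * (p : ℂ)‖ ≤ 1 := by
  have : 1 + (u - 1) * (p : ℂ) = ((1 - p : ℝ) : ℂ) + u * p := by push_cast; ring
  rw [this]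
  refine (norm_add_le _ _).trans ?_
  rw [norm_mul, hu, Complex.norm_real, Complex.norm_real, Real.norm_of_nonneg h0,
    Real.norm_of_nonneg (sub_nonneg.2 h1)]
  linarith

open Classical in
theorem integral_pow_numJobs {Ω₁ Ω₂ : Type*} {m₁ : MeasurableSpace Ω₁} {m₂ : MeasurableSpace Ω₂}
    (hlam : Continuous lam) (hkap : Continuous kap) (hmu : Continuous mu) (hf : IsCadlag f)
    {X : Ω → Ω₁} {W : Ω → Ω₂} (hX : Measurable X) (hW : Measurable W) (hXW : IndepFun X W P)
    {Y : ℝ≥0 → Ω₁ → ℕ} (hYm : ∀ s, Measurable (Y s)) (hYc : ∀ ω, IsCountingPath fun s => Y s ω)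
    (hY : IsStandardPoissonProcess (fun s ω => Y s (X ω)) P)
    {Z : ℕ → Ω₂ → ℝ} (hZm : ∀ k, Measurable (Z k))
    (hZ : ∀ k, HasLaw (fun ω => Z k (W ω)) (expMeasure 1) P)
    (hZi : iIndepFun (fun k ω => Z k (W ω)) P) (t : ℝ≥0) {u : ℂ} (hu : ‖u‖ = 1) :
    ∫ ω, u ^ numJobs lam kap mu f (fun s => Y s (X ω)) (fun k => Z k (W ω)) t ∂P =
      Complex.exp (poissonParameter lam kap mu t f * (u - 1)) := by
  have hpow (x : Ω₁) (w : Ω₂) :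
      u ^ numJobs lam kap mu f (fun s => Y s x) (fun k => Z k w) t =
        ∏ k ∈ Finset.range (arrivals lam f (fun s => Y s x) t),
          (if Served kap mu f t (entryTime lam f (fun s => Y s x) k) (Z (k + 1) w)
            then 1 else u) := by
    rw [(hYc x).numJobs_eq hlam hf, ← Finset.prod_pow_eq_pow_sum]
    refine Finset.prod_congr rfl fun k _ => ?_
    split_ifs <;> simp
  have hmeas : Measurable fun q : Ω₁ × Ω₂ =>
      u ^ numJobs lam kap mu f (fun s => Y s q.1) (fun k => Z k q.2) t :=
    (measurable_from_nat (f := fun n => u ^ n)).comp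
      (measurable_numJobs (J := fun s _ => f s) (Y := fun s (q : Ω₁ × Ω₂) => Y s q.1)
        (Z := fun k q => Z k q.2) hlam hkap hmu (fun s => measurable_const) (fun _ => hf)
        (fun s => (hYm s).comp measurable_fst) (fun q => hYc q.1)
        (fun k => (hZm k).comp measurable_snd) t)
  rw [integral_comp_prodMk_of_indepFun hX hW hXW
    (G := fun x w => u ^ numJobs lam kap mu f (fun s => Y s x) (fun k => Z k w) t) hmeas (C := 1)
    (fun x w => by simp [hu])]
  simp_rw [hpow, fun ω => integral_prod_served (Z := fun k ω => Z k (W ω)) hkap hmu hf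
    (fun k => (hZm k).comp hW) hZ hZi u t (entryTime lam f (fun s => Y s (X ω))) (arrivals lam f (fun s => Y s (X ω)) t)]
  rw [integral_prod_entryTime hY hlam hf (h := fun s => 1 + (u - 1) * (survival kap mu f t s : ℂ))
    (fun s => ?_) (fun s => norm_one_add_sub_one_mul_le hu (survival_nonneg _ _ _)
      (survival_le_one _ _ _))]
  · congr 1
    have hphi : (poissonParameter lam kap mu t f : ℂ) =
        ((poissonParameter lam kap mu t f : ℝ) : ℂ) := rfl
    rw [hphi, coe_poissonParameter, ← intervalIntegral.integral_ofReal,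
      ← intervalIntegral.integral_mul_const]
    refine intervalIntegral.integral_congr fun s _ => ?_
    push_cast
    ring
  · exact continuousWithinAt_const.add (continuousWithinAt_const.mul
      (Complex.continuous_ofReal.continuousAt.comp_continuousWithinAt
        (rightCont_survival hkap hmu hf t s)))

theorem hasLaw_poissonMeasure_of_integral_pow {M : Ω → ℕ} (hM : Measurable M) (r : ℝ≥0)
    (h : ∀ u : ℂ, ‖u‖ = 1 → ∫ ω, u ^ M ω ∂P = Complex.exp (r * (u - 1))) :
    HasLaw M (poissonMeasure r) P := by
  refine ⟨hM.aemeasurable, ?_⟩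
  have := Measure.isProbabilityMeasure_map (μ := P) hM.aemeasurable
  -- Pushed forward to `ℝ`, both laws are determined by their characteristic functions, and `u = exp
  -- (iθ)` turns the hypothesis into exactly that.
  apply (MeasurableEmbedding.natCast (α := ℝ)).map_injective
  have := Measure.isProbabilityMeasure_map (μ := P.map M) (f := (Nat.cast : ℕ → ℝ)) .of_discrete
  apply Measure.ext_of_charFun
  ext θ
  rw [charFun_map_cast_poissonMeasure, ← h _ (Complex.norm_exp_ofReal_mul_I θ), charFun_apply_real,
    integral_map .of_discrete (by fun_prop), integral_map hM.aemeasurable .of_discrete]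
  congr with ω
  rw [← Complex.exp_nat_mul]
  push_cast
  ring_nf

theorem hasLaw_numJobs (hlam : Continuous lam) (hkap : Continuous kap) (hmu : Continuous mu)
    (hf : IsCadlag f) (hY : IsStandardPoissonProcess Y P)
    {Z : ℕ → Ω → ℝ} (hZm : ∀ k, Measurable (Z k)) (hZ : ∀ k, HasLaw (Z k) (expMeasure 1) P)
    (hZi : iIndepFun Z P) (hYZ : IndepFun (fun ω s => Y s ω) (fun ω k => Z k ω) P) (t : ℝ≥0) :
    HasLaw (fun ω => numJobs lam kap mu f (fun s => Y s ω) (fun k => Z k ω) t)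
      (poissonMeasure (poissonParameter lam kap mu t f)) P := by
  refine hasLaw_poissonMeasure_of_integral_pow
    (measurable_numJobs (J := fun s _ => f s) hlam hkap hmu (fun s => measurable_const)
      (fun _ => hf) hY.measurable hY.isCountingPath hZm t) _ fun u hu => ?_
  have hind := indepFun_id_id_of_indep ((IndepFun_iff_Indep _ _ P).1 hYZ)
  exact integral_pow_numJobs (X := id) (W := id) hlam hkap hmu hf
    (measurable_id'' (measurable_pi_lambda _ hY.measurable).comap_le)
    (measurable_id'' (measurable_pi_lambda _ hZm).comap_le) hind
    (fun s => (measurable_pi_apply s).comp (comap_measurable fun ω s => Y s ω)) hY.isCountingPath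
    hY (fun k => (measurable_pi_apply k).comp (comap_measurable fun ω k => Z k ω)) hZ hZi t hu

end FixedPath

/-! ### Conditioning on the background process -/

theorem measurable_poissonMeasure : Measurable poissonMeasure := by
  refine Measure.measurable_of_measurable_coe _ fun A hA => ?_
  simp_rw [poissonMeasure, Measure.sum_apply _ hA, Measure.smul_apply, smul_eq_mul]
  refine Measurable.tsum fun n => Measurable.mul_const ?_ _
  exact (((Real.measurable_exp.comp measurable_coe_nnreal_real.neg).mul
    (measurable_coe_nnreal_real.pow_const n)).div_const _).ennreal_ofReal

/-- The joint law is a product, so its measure is computed by sections, and `K x A` is the measure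
of the section at `x`. This also yields measurability of `x ↦ K x A`. -/
theorem measure_preimage_inter_of_indepFun {Ω Ω₁ Ω₂ S : Type*} {mΩ : MeasurableSpace Ω}
    {m₁ : MeasurableSpace Ω₁} {m₂ : MeasurableSpace Ω₂} [MeasurableSpace S] {P : Measure Ω}
    [IsProbabilityMeasure P] {X : Ω → Ω₁} {W : Ω → Ω₂} (hX : Measurable X) (hW : Measurable W)
    (hXW : IndepFun X W P) {F : Ω₁ → Ω₂ → S} (hF : Measurable fun q : Ω₁ × Ω₂ => F q.1 q.2)
    {K : Ω₁ → Measure S} (hK : ∀ x, HasLaw (fun ω => F x (W ω)) (K x) P)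
    {B : Set Ω₁} (hB : MeasurableSet B) {A : Set S} (hA : MeasurableSet A) :
    P (X ⁻¹' B ∩ (fun ω => F (X ω) (W ω)) ⁻¹' A) = ∫⁻ ω in X ⁻¹' B, K (X ω) A ∂P := by
  have := Measure.isProbabilityMeasure_map (μ := P) hW.aemeasurable
  have hFx (x : Ω₁) : Measurable (F x) := hF.comp (measurable_const.prodMk measurable_id)
  have hKx (x : Ω₁) : P.map W (F x ⁻¹' A) = K x A := by
    rw [← (hK x).map_eq, Measure.map_apply hW (hFx x hA)]
    exact (Measure.map_apply ((hFx x).comp hW) hA).symm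
  have hmeas : Measurable fun x => K x A := by
    simp_rw [← hKx]
    exact measurable_measure_prodMk_left (hF hA)
  have hset : MeasurableSet (B ×ˢ univ ∩ (fun q : Ω₁ × Ω₂ => F q.1 q.2) ⁻¹' A) :=
    (hB.prod .univ).inter (hF hA)
  calc P (X ⁻¹' B ∩ (fun ω => F (X ω) (W ω)) ⁻¹' A)
      = P.map (fun ω => (X ω, W ω)) (B ×ˢ univ ∩ (fun q : Ω₁ × Ω₂ => F q.1 q.2) ⁻¹' A) := by
        rw [Measure.map_apply (hX.prodMk hW) hset]
        congr 1
        ext ω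
        simp
    _ = ∫⁻ x, B.indicator (fun x => K x A) x ∂(P.map X) := by
        rw [hXW.map_prod_eq_prod_map_map hX.aemeasurable hW.aemeasurable,
          Measure.prod_apply hset]
        congr with x
        by_cases hx : x ∈ B
        · rw [indicator_of_mem hx, ← hKx]
          congr 1
          ext w
          simp [hx]
        · rw [indicator_of_notMem hx]
          convert measure_empty (μ := P.map W)
          ext w
          simp [hx]
    _ = ∫⁻ ω in X ⁻¹' B, K (X ω) A ∂P := by
        rw [lintegral_indicator hB, setLIntegral_map hB hmeas hX]

theorem iSup_comap_eq_comap_pi {Ω ι : Type*} {E : ι → Type*} [∀ i, MeasurableSpace (E i)]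
    (J : ∀ i, Ω → E i) :
    ⨆ i, MeasurableSpace.comap (J i) inferInstance =
      MeasurableSpace.comap (fun ω i => J i ω) inferInstance := by
  simp only [MeasurableSpace.pi, MeasurableSpace.comap_iSup, MeasurableSpace.comap_comp]
  rfl

section Conditional

variable {Ω : Type*} [mΩ : MeasurableSpace Ω] {P : Measure Ω} [IsProbabilityMeasure P]
  {E : Type*} [MetricSpace E] [MeasurableSpace E] [BorelSpace E] {lam kap mu : E → ℝ≥0}
  {J : ℝ≥0 → Ω → E} {Ybar : ℝ≥0 → Ω → ℕ} {Zbar : ℕ → Ω → ℝ}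

theorem measure_inter_numJobs
    (hlam : Continuous lam) (hkap : Continuous kap) (hmu : Continuous mu)
    (hJ_meas : ∀ s, Measurable (J s)) (hJ_cadlag : ∀ ω, IsCadlag fun s => J s ω)
    (hY : IsStandardPoissonProcess Ybar P) (hZ_meas : ∀ k, Measurable (Zbar k))
    (hZ_law : ∀ k, HasLaw (Zbar k) (expMeasure 1) P) (hZ_indep : iIndepFun Zbar P)
    (hYZ : IndepFun (fun ω s => Ybar s ω) (fun ω k => Zbar k ω) P)
    (hJYZ : IndepFun (fun ω s => J s ω) (fun ω => (fun s => Ybar s ω, fun k => Zbar k ω)) P)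
    (t : ℝ≥0) {B : Set Ω}
    (hB : MeasurableSet[MeasurableSpace.comap (fun ω s => J s ω) inferInstance] B) (A : Set ℕ) :
    P (B ∩ (fun ω => numJobs lam kap mu (fun s => J s ω) (fun s => Ybar s ω)
        (fun k => Zbar k ω) t) ⁻¹' A) =
      ∫⁻ ω in B, poissonMeasure (poissonParameter lam kap mu t fun s => J s ω) A ∂P := by
  have hJ' : Measurable fun ω s => J s ω := measurable_pi_lambda _ hJ_meas
  have hYZ' : Measurable fun ω => ((fun s => Ybar s ω, fun k => Zbar k ω) : (ℝ≥0 → ℕ) × (ℕ → ℝ)) :=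
    (measurable_pi_lambda _ hY.measurable).prodMk (measurable_pi_lambda _ hZ_meas)
  have hind := indepFun_id_id_of_indep ((IndepFun_iff_Indep _ _ P).1 hJYZ)
  refine measure_preimage_inter_of_indepFun (X := id) (W := id)
    (F := fun ω₁ ω₂ => numJobs lam kap mu (fun s => J s ω₁) (fun s => Ybar s ω₂)
      (fun k => Zbar k ω₂) t)
    (K := fun ω₁ => poissonMeasure (poissonParameter lam kap mu t fun s => J s ω₁))
    (measurable_id'' hJ'.comap_le) (measurable_id'' hYZ'.comap_le) hind ?_
    (fun ω₁ => hasLaw_numJobs hlam hkap hmu (hJ_cadlag ω₁) hY hZ_meas hZ_law hZ_indep hYZ t)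
    hB (.of_discrete (s := A))
  have c₁ := comap_measurable (m := inferInstance) fun ω s => J s ω
  have c₂ := comap_measurable (m := inferInstance) fun ω =>
    ((fun s => Ybar s ω, fun k => Zbar k ω) : (ℝ≥0 → ℕ) × (ℕ → ℝ))
  -- Joint measurability is needed for the product of the σ-algebras generated by `J` and by the
  -- driving pair, with the background read from the first coordinate and the driving processes from
  -- the second.
  exact @measurable_numJobs E lam kap mu _ (Ω × Ω) (@Prod.instMeasurableSpace Ω Ω
      (MeasurableSpace.comap (fun ω s => J s ω) inferInstance)
      (MeasurableSpace.comap (fun ω =>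
        ((fun s => Ybar s ω, fun k => Zbar k ω) : (ℝ≥0 → ℕ) × (ℕ → ℝ))) inferInstance)) _ _
    (fun s q => J s q.1) (fun s q => Ybar s q.2) (fun k q => Zbar k q.2) hlam hkap hmu
    (fun s => ((measurable_pi_apply s).comp c₁).comp (@measurable_fst _ _ (_) (_)))
    (fun q => hJ_cadlag q.1)
    (fun s => ((measurable_pi_apply s).comp c₂.fst).comp (@measurable_snd _ _ (_) (_)))
    (fun q => hY.isCountingPath q.2)
    (fun k => ((measurable_pi_apply k).comp c₂.snd).comp (@measurable_snd _ _ (_) (_))) t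

theorem condExp_eq_of_measure_inter {m : MeasurableSpace Ω} (hm : m ≤ mΩ) {M : Ω → ℕ}
(hM : Measurable[mΩ] M) {phi : Ω → ℝ≥0} (hphi : Measurable[m] phi) (A : Set ℕ)
    (h : ∀ B, MeasurableSet[m] B →
      P (B ∩ M ⁻¹' A) = ∫⁻ ω in B, poissonMeasure (phi ω) A ∂P) :
    P⟦M ⁻¹' A | m⟧ =ᵐ[P] fun ω => (poissonMeasure (phi ω)).real A := by
  have hA : MeasurableSet A := .of_discrete
  have hmeas : Measurable[m] fun ω => poissonMeasure (phi ω) A :=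
    ((Measure.measurable_coe hA).comp measurable_poissonMeasure).comp hphi
  have hint : Integrable (fun ω => (poissonMeasure (phi ω)).real A) P :=
    Integrable.of_bound (hmeas.ennreal_toReal.mono hm le_rfl).aestronglyMeasurable 1
      (.of_forall fun ω => by
        rw [Real.norm_of_nonneg measureReal_nonneg]
        exact measureReal_le_one)
  refine (ae_eq_condExp_of_forall_setIntegral_eq hm
    ((integrable_const (1 : ℝ)).indicator (hM hA)) (fun _ _ _ => hint.integrableOn)
    (fun B hB _ => ?_) hmeas.ennreal_toReal.stronglyMeasurable.aestronglyMeasurable).symm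
  rw [integral_indicator_const _ (hM hA), measureReal_restrict_apply (hM hA), inter_comm,
    measureReal_def, h B hB, smul_eq_mul, mul_one]
  exact integral_toReal (hmeas.mono hm le_rfl).aemeasurable
    (.of_forall fun ω => measure_lt_top _ _)

end Conditional

end ModulatedQueue

end

theorem mainTheorem2 {Ω : Type*} [MeasurableSpace Ω] (P : Measure Ω) [IsProbabilityMeasure P]
    {E : Type*} [MetricSpace E] [MeasurableSpace E] [BorelSpace E]
    -- the modulating functions
    (lam kap mu : E → ℝ≥0)
    (hlam : Continuous lam) (hkap : Continuous kap) (hmu : Continuous mu)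
    -- the background process
    (J : ℝ≥0 → Ω → E) (hJ_meas : ∀ s, Measurable (J s))
    (hJ_cadlag : ∀ ω, ModulatedQueue.IsCadlag fun s => J s ω)
    -- the standard Poisson process that drives the arrivals
    (Ybar : ℝ≥0 → Ω → ℕ) (hY : ModulatedQueue.IsStandardPoissonProcess Ybar P)
    -- the standard exponential random variables that drive the service requirements
    (Zbar : ℕ → Ω → ℝ) (hZ_meas : ∀ k, Measurable (Zbar k))
    (hZ_law : ∀ k, HasLaw (Zbar k) (expMeasure 1) P) (hZ_indep : iIndepFun Zbar P)
    -- the background process, the Poisson process and the exponential sequence are independent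
    (hYZ : IndepFun (fun ω s => Ybar s ω) (fun ω k => Zbar k ω) P)
    (hJYZ : IndepFun (fun ω s => J s ω) (fun ω => (fun s => Ybar s ω, fun k => Zbar k ω)) P)
    (t : ℝ≥0) :
    let M : Ω → ℕ := fun ω =>
      ModulatedQueue.numJobs lam kap mu (fun s => J s ω) (fun s => Ybar s ω)
        (fun k => Zbar k ω) t
    let phi : Ω → ℝ≥0 := fun ω =>
      ModulatedQueue.poissonParameter lam kap mu t (fun s => J s ω)
    -- almost surely only finitely many jobs have entered by time `t`, and `M` and `phi` are
    -- random variables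
    (∀ᵐ ω ∂P, {k : ℕ | 1 ≤ k ∧
        ModulatedQueue.HasEntered lam (fun s => J s ω) (fun s => Ybar s ω) t k}.Finite) ∧
    Measurable M ∧ Measurable phi ∧
    -- given the whole background process, `M` is Poisson distributed with parameter `phi`
    (∀ A : Set ℕ, P⟦M ⁻¹' A | ⨆ s, MeasurableSpace.comap (J s) inferInstance⟧
        =ᵐ[P] fun ω => (poissonMeasure (phi ω)).real A) ∧
    -- the law of `M` is the corresponding mixture of Poisson distributions
    HasLaw M (P.bind fun ω => poissonMeasure (phi ω)) P := by
  intro M phi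
  have hM : Measurable M := ModulatedQueue.measurable_numJobs hlam hkap hmu hJ_meas hJ_cadlag
    hY.measurable hY.isCountingPath hZ_meas t
  have hphi : Measurable phi :=
    ModulatedQueue.measurable_poissonParameter hlam hkap hmu hJ_meas hJ_cadlag t
  have hle : MeasurableSpace.comap (fun ω s => J s ω) inferInstance ≤ ‹MeasurableSpace Ω› :=
    (measurable_pi_lambda _ hJ_meas).comap_le
  -- The same measurability lemma, with `σ(J)` as the σ-algebra on `Ω`: a conditional expectation
  -- must be measurable for it.
  have hphi' : Measurable[MeasurableSpace.comap (fun ω s => J s ω) inferInstance] phi :=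
    @ModulatedQueue.measurable_poissonParameter E lam kap mu _ Ω (_) _ _ J hlam hkap hmu
      (fun s => (measurable_pi_apply s).comp (comap_measurable fun ω s => J s ω)) hJ_cadlag t
  have hinter : ∀ (A : Set ℕ) (B : Set Ω),
      MeasurableSet[MeasurableSpace.comap (fun ω s => J s ω) inferInstance] B →
      P (B ∩ M ⁻¹' A) = ∫⁻ ω in B, poissonMeasure (phi ω) A ∂P := fun A B hB =>
    ModulatedQueue.measure_inter_numJobs hlam hkap hmu hJ_meas hJ_cadlag hY hZ_meas hZ_law
      hZ_indep hYZ hJYZ t hB A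
  refine ⟨.of_forall fun ω => (hY.isCountingPath ω).finite_hasEntered hlam (hJ_cadlag ω) t,
    hM, hphi, fun A => ?_, hM.aemeasurable, ?_⟩
  · rw [ModulatedQueue.iSup_comap_eq_comap_pi]
    exact ModulatedQueue.condExp_eq_of_measure_inter hle hM hphi' A (hinter A)
  · ext A hA
    have hK : AEMeasurable (fun ω => poissonMeasure (phi ω)) P :=
      (ModulatedQueue.measurable_poissonMeasure.comp hphi).aemeasurable
    rw [Measure.map_apply hM hA, Measure.bind_apply hA hK]
    simpa using hinter A univ .univ
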